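/- Let $\mathbb F$ be a field of characteristic zero and $L$ a finite-dimensional Lie algebra over $\mathbb F$. Write $L^2=[L,L]$, let $\operatorname{Rad}(L)$ be the solvable radical and $Z(L)$ the centre of $L$, and let $\mathcal J(L)$ be the Jacobson radical, i.e. the intersection of all maximal ideals of $L$ (with $\mathcal J(0)=0$). A Levi factor of a Lie algebra $M$ is a semisimple subalgebra $S$ (possibly $0$) with $M=S\oplus\operatorname{Rad}(M)$; all direct sums are direct sums of vector spaces. Suppose $L=M\oplus\mathbb Fz$, where $M$ is an ideal of $L$ with $M^2=M$ and $0\neq z\in Z(L)$. Then $\mathcal J(L)=\mathcal J(M)$, $\operatorname{Rad}(L)=\mathbb Fz\oplus\mathcal J(L)$, $L^2=M^2=M$, and $M$ has a Levi factor. Moreover, for every Levi factor $S$ of $M$, the following hold. 1. $L^2=S\oplus\mathcal J(L)$, and $S\neq0$ if $M\neq0$. 2. Let $\mathcal J_0(M)=\{x\in\mathcal J(M): [s,x]=0 \text{ for all } s\in S\}$. A subspace of $L$ is an ideal of $L$ if and only if it is of one of the following types: (i) an ideal $I_M$ of $M$; (ii) $I_M\oplus\mathbb Fz$ with $I_M$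 an ideal of $M$; (iii) (only if $\mathcal J_0(M)\ne0$) $\mathbf I(I_M,x)=I_M\oplus\mathbb F(x+z)$, where $I_M$ is an ideal of $M$, $x\in\mathcal J_0(M)\setminus I_M$ and $[x,\mathcal J(M)]\subseteq I_M$. 3. If $(I_M,x)$ is a pair as in (iii), then $\mathbf I(I_M,\alpha x)=I_M\oplus\mathbb F(\alpha x+z)$ is an ideal of $L$ for every $\alpha\in\mathbb F$, and for $\alpha,\beta\in\mathbb F$ one has $\mathbf I(I_M,\alpha x)=\mathbf I(I_M,\beta x)$ if and only if $\alpha=\beta$. -/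

import Mathlib

/-- The Jacobson radical of a Lie algebra: the intersection of all its maximal ideals. -/
def lieJacobson (F L : Type*) [Field F] [LieRing L] [LieAlgebra F L] : LieIdeal F L :=
  sInf {I : LieIdeal F L | IsCoatom I}

/-- A Levi factor of a Lie algebra `L`: a semisimple subalgebra `S` such that `L = S ⊕ Rad(L)`
as a vector space. (The zero algebra counts as semisimple.) -/
structure IsLeviFactor {F L : Type*} [Field F] [LieRing L] [LieAlgebra F L]
    (S : LieSubalgebra F L) : Prop where
  semisimple : LieAlgebra.IsSemisimple F S
  isCompl : IsCompl S.toSubmodule (LieAlgebra.radical F L).toSubmodule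

/-- `V = A ⊕ B`: the subspace `V` is the internal direct sum of the subspaces `A` and `B`. -/
def IsInternalSum {F L : Type*} [Field F] [AddCommGroup L] [Module F L]
    (V A B : Submodule F L) : Prop :=
  V = A ⊔ B ∧ Disjoint A B

/-- A subspace is an ideal. -/
def IsLieIdeal {F L : Type*} [Field F] [LieRing L] [LieAlgebra F L] (V : Submodule F L) : Prop :=
  ∃ I : LieIdeal F L, I.toSubmodule = V

/-- A subspace of the ideal `M`, seen as a subspace of `L`. -/
def subspaceIn {F L : Type*} [Field F] [LieRing L] [LieAlgebra F L] (M : LieIdeal F L)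
    (V : Submodule F M) : Submodule F L :=
  V.map (LieSubmodule.incl M : M →ₗ[F] L)

/-- For a subalgebra `S` of `M`, the trivial `ad S`-module of the Jacobson radical of `M`:
all `x ∈ J(M)` with `[s, x] = 0` for every `s ∈ S`. -/
def lieJacobsonTrivial {F M : Type*} [Field F] [LieRing M] [LieAlgebra F M]
    (S : LieSubalgebra F M) : Submodule F M :=
  (lieJacobson F M).toSubmodule ⊓ (LieModule.maxTrivSubmodule F S M).toSubmodule

/-- The subspace `I + F (x + z)` of `L`, for an ideal `I` of `M`, `x ∈ M` and `z ∈ L`. -/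
def shiftedIdeal {F L : Type*} [Field F] [LieRing L] [LieAlgebra F L] (M : LieIdeal F L) (z : L)
    (I : LieIdeal F M) (x : M) : Submodule F L :=
  subspaceIn M I.toSubmodule ⊔ Submodule.span F {(x : L) + z}

/-- The condition on a pair `(I, x)`: `x` lies in the trivial `ad S`-module of `J(M)` but not
in `I`, and `[x, J(M)] ⊆ I`. -/
def IsShiftPair {F M : Type*} [Field F] [LieRing M] [LieAlgebra F M]
    (S : LieSubalgebra F M) (I : LieIdeal F M) (x : M) : Prop :=
  x ∈ lieJacobsonTrivial S ∧ x ∉ I ∧ ∀ y ∈ lieJacobson F M, ⁅x, y⁆ ∈ I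

/-! Three facts carry the theorem. In characteristic zero `𝒥(L) = [L, L] ∩ Rad L`
(`lieJacobson_eq_inf_radical`): a maximal ideal contains either `[L, L]` or the radical, and the
converse inclusions come from hyperplanes and from the semisimple quotient. Levi's theorem
(`exists_isLeviFactor`) gives `S`. Whitehead's first lemma (`exists_lie_eq_of_cocycle`) underlies
Levi's theorem and also lets an element be moved into the centralizer of `S`.

Since `z` is central, `L` acts through `M`, so ideals of `M` are ideals of `L` and `[L, L] = M`. As
`M` is perfect, `𝒥(M) = Rad M`, and the structural equalities follow.

For the ideals, let `V` not be contained in `M`. After scaling it contains `m + z`, and `m` is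
central modulo `I = V ∩ M`. Modulo `I`, `m` may be replaced by some `x` in `Rad M` commuting with
`S` (`exists_mem_radical_centralizer_of_central_mod`), and `V = I ⊕ F(x + z)`. If `x ∈ I` this is `I
⊕ Fz`; otherwise `(I, x)` is a pair of type (iii). -/

/-! ### Dual bases for an invariant form. -/

section InvariantForm

variable {F g : Type*} [Field F] [CharZero F] [LieRing g] [LieAlgebra F g] [FiniteDimensional F g]

open LieAlgebra in
/-- A nonzero invariant symmetric form on a semisimple Lie algebra is nondegenerate on a nonzero
ideal; a pair of dual bases of this ideal transforms contragrediently under the adjoint action. -/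
theorem exists_dual_families_of_invariant [HasTrivialRadical F g] (B : LinearMap.BilinForm F g)
    (hsymm : ∀ x y, B x y = B y x) (hinv : B.lieInvariant g) (hB : B ≠ 0) :
    ∃ (n : ℕ) (x x' : Fin n → g), n ≠ 0 ∧ (∀ i, B (x i) (x' i) = 1) ∧
      ∀ y : g, ∃ a : Fin n → Fin n → F, (∀ i, ⁅y, x i⁆ = ∑ j, a i j • x j) ∧
        ∀ i, ⁅y, x' i⁆ = -∑ j, a j i • x' j := by
  classical
  -- `I` is the radical of the form; on its Killing complement `J` the form is nondegenerate.
  set I : LieIdeal F g := InvariantForm.orthogonal B hinv ⊤ with hIdef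
  have hI : ∀ y, y ∈ I ↔ ∀ x, B x y = 0 := fun y ↦ by
    simp [hIdef, InvariantForm.mem_orthogonal]
  set J := I.killingCompl
  have hIJ : IsCompl I J := I.isCompl_killingCompl
  let BJ : LinearMap.BilinForm F J := B.domRestrict₁₂ J.toSubmodule J.toSubmodule
  have hBJ (u v : J) : BJ u v = B u v := rfl
  have hsym : LinearMap.IsSymm BJ := ⟨fun u v ↦ hsymm _ _⟩
  have hnd : BJ.Nondegenerate := by
    refine hsym.isRefl.nondegenerate_iff_separatingLeft.mpr fun u hu ↦ ?_
    have huI : (u : g) ∈ I := (hI _).mpr fun w ↦ by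
      have hw : w ∈ I ⊔ J := by rw [hIJ.sup_eq_top]; trivial
      obtain ⟨p, hp, q, hq, rfl⟩ := (LieSubmodule.mem_sup _ _ _).mp hw
      have h1 : B p u = 0 := by rw [hsymm]; exact (hI p).mp hp _
      have h2 : B q u = 0 := by rw [hsymm]; exact hu ⟨q, hq⟩
      rw [map_add, LinearMap.add_apply, h1, h2, add_zero]
    have h0 : (u : g) ∈ I ⊓ J := ⟨huI, u.2⟩
    rw [hIJ.inf_eq_bot] at h0
    exact Subtype.ext (by simpa using h0)
  let b := Module.finBasis F J
  let b' := BJ.dualBasis hnd b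
  refine ⟨Module.finrank F J, fun i ↦ b i, fun i ↦ b' i, ?_, fun i ↦ ?_, fun y ↦ ?_⟩
  · intro h0
    rw [Module.finrank_zero_iff] at h0
    have hJ : J = ⊥ := by
      rw [eq_bot_iff]
      intro u hu
      have := Subsingleton.elim (⟨u, hu⟩ : J) 0
      simpa using congrArg Subtype.val this
    have hIt : I = ⊤ := by simpa [hJ] using hIJ.sup_eq_top
    refine hB (LinearMap.ext₂ fun u v ↦ (hI v).mp ?_ u)
    rw [hIt]; trivial
  · rw [← hBJ, LinearMap.BilinForm.apply_dualBasis_right hnd ⟨hsym.eq⟩]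
    simp
  · have hr (u : J) (j) : b.repr u j = B u (b' j) := by
      have h1 (i) : BJ (b i) (b' j) = if i = j then 1 else 0 :=
        LinearMap.BilinForm.apply_dualBasis_right hnd ⟨hsym.eq⟩ b i j
      have h2 : BJ (∑ i, b.repr u i • b i) (b' j) = b.repr u j := by
        rw [map_sum, LinearMap.sum_apply]
        simp only [map_smul, LinearMap.smul_apply, h1]
        simp
      rw [← h2, b.sum_repr, hBJ]
    have hr' (u : J) (j) : b'.repr u j = B u (b j) := by
      rw [LinearMap.BilinForm.dualBasis_repr_apply, hBJ]
    refine ⟨fun i j ↦ b.repr ⁅y, b i⁆ j, fun i ↦ ?_, fun i ↦ ?_⟩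
    · have := congrArg Subtype.val (b.sum_repr ⁅y, b i⁆).symm
      rw [LieSubmodule.coe_bracket] at this
      rw [this]
      push_cast
      rfl
    · have := congrArg Subtype.val (b'.sum_repr ⁅y, b' i⁆).symm
      rw [LieSubmodule.coe_bracket] at this
      rw [this, ← Finset.sum_neg_distrib]
      push_cast
      refine Finset.sum_congr rfl fun j _ ↦ ?_
      rw [hr, hr', ← neg_smul]
      congr 1
      simp only [LieSubmodule.coe_bracket]
      rw [hinv, hsymm]

end InvariantForm

/-! ### Invariance of the Casimir tensor. -/

section Casimir

variable {F g : Type*} [Field F] [LieRing g] [LieAlgebra F g]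

/-- The two matrices are negative transposes, so `∑ xᵢ ⊗ x'ᵢ` is killed by `y`. A general bilinear
`β` serves both the Casimir operator and its analogue twisted by a cocycle. -/
theorem sum_lie_dual_families_eq_zero {n : ℕ} (x x' : Fin n → g) (y : g)
    (a : Fin n → Fin n → F) (h : ∀ i, ⁅y, x i⁆ = ∑ j, a i j • x j)
    (h' : ∀ i, ⁅y, x' i⁆ = -∑ j, a j i • x' j) {W : Type*} [AddCommGroup W] [Module F W]
    (β : g →ₗ[F] g →ₗ[F] W) : ∑ i, (β ⁅y, x i⁆ (x' i) + β (x i) ⁅y, x' i⁆) = 0 := by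
  simp only [h, h', map_sum, map_smul, map_neg, LinearMap.sum_apply, LinearMap.smul_apply,
    Finset.sum_add_distrib, Finset.sum_neg_distrib]
  rw [Finset.sum_comm, add_neg_eq_zero]

end Casimir

/-! ### Whitehead's first lemma. -/

section Whitehead

universe u

open LieAlgebra LieModule

variable {F g : Type*} [Field F] [CharZero F] [LieRing g] [LieAlgebra F g] [FiniteDimensional F g]
  [HasTrivialRadical F g]

/-- Brackets in the Killing complement of `[g, g]` also lie in `[g, g]`, hence vanish; an abelian
ideal is zero. -/
theorem LieAlgebra.HasTrivialRadical.derivedSeries_one_eq_top :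
    derivedSeries F g 1 = ⊤ := by
  have hc := (derivedSeries F g 1).isCompl_killingCompl
  suffices (derivedSeries F g 1).killingCompl = ⊥ by rw [← hc.sup_eq_top, this, sup_bot_eq]
  have : IsLieAbelian (derivedSeries F g 1).killingCompl := by
    refine ⟨fun u v ↦ Subtype.ext ?_⟩
    have h0 : ⁅(u : g), (v : g)⁆ ∈ derivedSeries F g 1 ⊓ (derivedSeries F g 1).killingCompl :=
      ⟨LieSubmodule.lie_mem_lie (LieSubmodule.mem_top _) (LieSubmodule.mem_top _),
        lie_mem_right F g _ _ _ v.2⟩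
    rw [hc.inf_eq_bot] at h0
    simpa using h0
  exact HasTrivialRadical.eq_bot_of_isSolvable _

variable {V : Type u} [AddCommGroup V] [Module F V] [LieRingModule g V] [LieModule F g V]
  [FiniteDimensional F V]

/-- If the trace form is nonzero, its Casimir operator `c` is invertible by Schur's lemma, and `c v
= ∑ [xᵢ, f x'ᵢ]` determines the primitive `v`. If it vanishes, the module is trivial, and a cocycle
kills brackets, which span `g`. -/
theorem exists_lie_eq_of_cocycle_of_isIrreducible [IsIrreducible F g V] (f : g →ₗ[F] V)
    (hf : ∀ x y, f ⁅x, y⁆ = ⁅x, f y⁆ - ⁅y, f x⁆) : ∃ v : V, ∀ x, f x = ⁅x, v⁆ := by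
  by_cases hB : traceForm F g V = 0
  · have hnil : LieModule.IsNilpotent g V := by
      have := isNilpotent_derivedSeries_of_traceForm_eq_zero hB
      rw [LieModule.isNilpotent_iff_forall' (R := F)] at this ⊢
      intro x
      have hx : x ∈ derivedSeries F g 1 := by
        rw [HasTrivialRadical.derivedSeries_one_eq_top]; trivial
      exact this ⟨x, hx⟩
    have hmax : maxTrivSubmodule F g V = ⊤ := by
      have := LieModule.nontrivial_of_isIrreducible F g V
      have := LieModule.nontrivial_max_triv_of_isNilpotent F g V
      exact (IsSimpleOrder.eq_bot_or_eq_top _).resolve_left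
        ((LieSubmodule.nontrivial_iff_ne_bot F g V).mp this)
    have htriv (x : g) (v : V) : ⁅x, v⁆ = 0 := by
      have : v ∈ maxTrivSubmodule F g V := by rw [hmax]; trivial
      exact this x
    refine ⟨0, fun x ↦ ?_⟩
    have hx : x ∈ derivedSeries F g 1 := by
      rw [HasTrivialRadical.derivedSeries_one_eq_top]; trivial
    rw [lie_zero]
    rw [derivedSeries_def, derivedSeriesOfIdeal_succ, derivedSeriesOfIdeal_zero,
      ← LieSubmodule.mem_toSubmodule, LieSubmodule.lieIdeal_oper_eq_linear_span'] at hx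
    induction hx using Submodule.span_induction with
    | mem _ h => obtain ⟨p, -, q, -, rfl⟩ := h; simp [hf, htriv]
    | zero => simp
    | add _ _ _ _ h1 h2 => simp [h1, h2]
    | smul _ _ _ h => simp [h]
  · obtain ⟨n, x, x', hn, hdual, ha⟩ := exists_dual_families_of_invariant (traceForm F g V)
      (traceForm_comm F g V) (traceForm_lieInvariant F g V) hB
    let ρ := toEnd F g V
    let c : Module.End F V := ∑ i, ρ (x i) * ρ (x' i)
    have hcv (v : V) : c v = ∑ i, ⁅x i, ⁅x' i, v⁆⁆ := by simp [c, ρ]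
    -- Each summand has trace `B(xᵢ, x'ᵢ) = 1`; in characteristic zero this prevents `c = 0`.
    have htr : LinearMap.trace F V c = n := by
      have this (i : Fin n) : LinearMap.trace F V (ρ (x i) * ρ (x' i)) = 1 := hdual i
      simp [c, this]
    have hcomm (y : g) (v : V) : ⁅y, c v⁆ = c ⁅y, v⁆ := by
      obtain ⟨a, h, h'⟩ := ha y
      have := sum_lie_dual_families_eq_zero x x' y a h h'
        (LinearMap.mk₂ F (fun p q ↦ ⁅p, ⁅q, v⁆⁆) (by simp) (by simp) (by simp) (by simp))
      rw [← sub_eq_zero, ← this, hcv, hcv, lie_sum, ← Finset.sum_sub_distrib]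
      refine Finset.sum_congr rfl fun i _ ↦ ?_
      simp only [LinearMap.mk₂_apply]
      rw [leibniz_lie y (x i), leibniz_lie y (x' i), lie_add]
      abel
    let K : LieSubmodule F g V :=
      { LinearMap.ker c with
        lie_mem := fun {y v} hv ↦ by
          have hv : c v = 0 := hv
          change c ⁅y, v⁆ = 0
          rw [← hcomm, hv, lie_zero] }
    have hK : K = ⊥ := by
      refine (IsSimpleOrder.eq_bot_or_eq_top K).resolve_right fun hK ↦ ?_
      have hc0 : c = 0 := LinearMap.ext fun v ↦ by
        have : v ∈ K := by rw [hK]; trivial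
        exact this
      rw [hc0, map_zero] at htr
      exact hn (by exact_mod_cast htr.symm)
    have hinj : Function.Injective c := by
      rw [← LinearMap.ker_eq_bot, eq_bot_iff]
      intro v hv
      have : v ∈ K := hv
      rw [hK] at this
      simpa using this
    obtain ⟨v, hv⟩ := (LinearMap.injective_iff_surjective.mp hinj) (∑ i, ⁅x i, f (x' i)⁆)
    refine ⟨v, fun y ↦ hinj ?_⟩
    obtain ⟨a, h, h'⟩ := ha y
    have := sum_lie_dual_families_eq_zero x x' y a h h'
      (LinearMap.mk₂ F (fun p q ↦ ⁅p, f q⁆) (by simp) (by simp) (by simp) (by simp))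
    rw [← hcomm, hv, hcv, lie_sum, ← sub_eq_zero, ← neg_sub, ← Finset.sum_sub_distrib,
      neg_eq_zero, ← this]
    refine Finset.sum_congr rfl fun i _ ↦ ?_
    simp only [LinearMap.mk₂_apply, hf, lie_sub]
    rw [leibniz_lie y (x i)]
    abel

/-- Whitehead's first lemma. -/
theorem exists_lie_eq_of_cocycle (f : g →ₗ[F] V)
    (hf : ∀ x y, f ⁅x, y⁆ = ⁅x, f y⁆ - ⁅y, f x⁆) : ∃ v : V, ∀ x, f x = ⁅x, v⁆ := by
  induction hd : Module.finrank F V using Nat.strong_induction_on generalizing V with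
  | _ d ih =>
  by_cases hirr : IsIrreducible F g V
  · exact exists_lie_eq_of_cocycle_of_isIrreducible f hf
  by_cases hV : Subsingleton V
  · exact ⟨0, fun x ↦ Subsingleton.elim _ _⟩
  rw [not_subsingleton_iff_nontrivial] at hV
  obtain ⟨W, hbot, htop⟩ : ∃ W : LieSubmodule F g V, W ≠ ⊥ ∧ W ≠ ⊤ := by
    by_contra! h
    exact hirr (IsIrreducible.mk h)
  have hsum := Submodule.finrank_quotient_add_finrank W.toSubmodule
  have hWpos : 0 < Module.finrank F W := by
    have := (LieSubmodule.nontrivial_iff_ne_bot F g V).mpr hbot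
    exact Module.finrank_pos
  have hWlt : Module.finrank F W < Module.finrank F V :=
    Submodule.finrank_lt (s := W.toSubmodule) (by simpa using htop)
  have hQlt : Module.finrank F (V ⧸ W) < d := by
    change Module.finrank F (V ⧸ W.toSubmodule) < d
    change 0 < Module.finrank F W.toSubmodule at hWpos
    omega
  have hfinQ : FiniteDimensional F (V ⧸ W) :=
    inferInstanceAs (FiniteDimensional F (V ⧸ W.toSubmodule))
  -- Solve modulo `W`, subtract the resulting coboundary, then solve in `W`.
  obtain ⟨q, hq⟩ := ih _ hQlt ((LieSubmodule.Quotient.mk' W : V →ₗ[F] V ⧸ W) ∘ₗ f)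
    (fun x y ↦ by
      simp only [LinearMap.comp_apply, hf, LieModuleHom.coe_toLinearMap, map_sub,
        LieModuleHom.map_lie]) rfl
  obtain ⟨v, rfl⟩ := LieSubmodule.Quotient.surjective_mk' W q
  have hmem (x : g) : f x - ⁅x, v⁆ ∈ W := by
    rw [← LieSubmodule.Quotient.mk_eq_zero, map_sub, LieModuleHom.map_lie, ← hq x]
    simp
  let f' : g →ₗ[F] W :=
    LinearMap.codRestrict W.toSubmodule (f - (toEnd F g V : g →ₗ[F] Module.End F V).flip v) hmem
  have hf'c (x : g) : (f' x : V) = f x - ⁅x, v⁆ := rfl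
  obtain ⟨w, hw⟩ := ih _ (hd ▸ hWlt) f' (fun x y ↦ Subtype.ext (by
    simp only [hf'c, hf, LieSubmodule.coe_sub, LieSubmodule.coe_bracket, lie_sub, lie_lie]
    abel)) rfl
  refine ⟨v + w, fun x ↦ ?_⟩
  have := congrArg Subtype.val (hw x)
  rw [hf'c, LieSubmodule.coe_bracket, sub_eq_iff_eq_add] at this
  rw [this, lie_add, add_comm]

end Whitehead

/-! ### Splitting of extensions of semisimple algebras by solvable kernels. -/

section Levi

universe u

open LieAlgebra LieModule

variable {F g : Type*} [Field F] [CharZero F] [LieRing g] [LieAlgebra F g] [FiniteDimensional F g]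
  [HasTrivialRadical F g]

/-- Whitehead's first lemma for a representation that factors through a semisimple quotient. -/
theorem exists_lie_eq_of_cocycle_of_surjective {L V : Type*} [LieRing L] [LieAlgebra F L]
    [AddCommGroup V] [Module F V] [LieRingModule L V] [LieModule F L V] [FiniteDimensional F V]
    (π : L →ₗ⁅F⁆ g) (hπ : Function.Surjective π) (hker : ∀ x, π x = 0 → ∀ v : V, ⁅x, v⁆ = 0)
    (f : L →ₗ[F] V) (hf : ∀ x y, f ⁅x, y⁆ = ⁅x, f y⁆ - ⁅y, f x⁆)
    (hfker : ∀ x, π x = 0 → f x = 0) : ∃ v : V, ∀ x, f x = ⁅x, v⁆ := by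
  obtain ⟨s, hs⟩ := (π : L →ₗ[F] g).exists_rightInverse_of_surjective
    (LinearMap.range_eq_top.mpr hπ)
  replace hs (y : g) : π (s y) = y := LinearMap.congr_fun hs y
  have hlie (x y : L) (h : π x = π y) (v : V) : ⁅x, v⁆ = ⁅y, v⁆ := by
    rw [← sub_eq_zero, ← sub_lie]
    exact hker _ (by rw [map_sub, h, sub_self]) v
  have hfeq (x y : L) (h : π x = π y) : f x = f y := by
    rw [← sub_eq_zero, ← map_sub]
    exact hfker _ (by rw [map_sub, h, sub_self])
  let _ : LieRingModule g V :=
    { bracket := fun y v ↦ ⁅s y, v⁆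
      add_lie := fun x y v ↦ by rw [map_add, add_lie]
      lie_add := fun x v w ↦ lie_add (s x) v w
      leibniz_lie := fun x y v ↦ by
        change ⁅s x, ⁅s y, v⁆⁆ = ⁅s ⁅x, y⁆, v⁆ + ⁅s y, ⁅s x, v⁆⁆
        rw [hlie (s ⁅x, y⁆) ⁅s x, s y⁆ (by simp [hs]), ← leibniz_lie] }
  have hbr (y : g) (v : V) : ⁅y, v⁆ = ⁅s y, v⁆ := rfl
  have : LieModule F g V :=
    { smul_lie := fun t x v ↦ by rw [hbr, hbr, map_smul, smul_lie]
      lie_smul := fun t x v ↦ by rw [hbr, hbr, lie_smul] }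
  obtain ⟨v, hv⟩ := exists_lie_eq_of_cocycle (f ∘ₗ s) (fun x y ↦ by
    simp only [LinearMap.comp_apply, hbr]
    rw [hfeq (s ⁅x, y⁆) ⁅s x, s y⁆ (by simp [hs]), hf])
  refine ⟨v, fun x ↦ ?_⟩
  rw [hfeq x (s (π x)) (hs _).symm, hlie x (s (π x)) (hs _).symm]
  exact hv (π x)

variable {L : Type u} [LieRing L] [LieAlgebra F L] [FiniteDimensional F L]

/-- If `π : L → g` is a surjection onto a semisimple Lie algebra with abelian kernel `R`, then there
is a linear projection onto `R` whose derivatives along `L` are inner derivations given by `R`. -/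
theorem exists_projection_lie_eq_inner (π : L →ₗ⁅F⁆ g) (hπ : Function.Surjective π)
    (hab : ∀ x y : L, π x = 0 → π y = 0 → ⁅x, y⁆ = 0) :
    ∃ φ : L →ₗ[F] L, (∀ x, π (φ x) = 0) ∧ (∀ r, π r = 0 → φ r = r) ∧
      ∀ x : L, ∃ r : L, π r = 0 ∧ ∀ y : L, ⁅x, φ y⁆ - φ ⁅x, y⁆ = ⁅r, y⁆ := by
  -- `N` holds the differences of projections onto `ker π`, and `P` the maps `ad r` with `r ∈ ker
  -- π`. Since `ker π` is abelian, it acts trivially on `N`.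
  let N : LieSubmodule F L (L →ₗ[F] L) :=
    { carrier := {φ | (∀ x, π (φ x) = 0) ∧ ∀ r, π r = 0 → φ r = 0}
      add_mem' := fun {a b} ha hb ↦ ⟨fun x ↦ by simp [ha.1, hb.1], fun r hr ↦ by
        simp [ha.2 r hr, hb.2 r hr]⟩
      zero_mem' := by simp
      smul_mem' := fun c a ha ↦ ⟨fun x ↦ by simp [ha.1], fun r hr ↦ by simp [ha.2 r hr]⟩
      lie_mem := fun {x a} ha ↦ ⟨fun y ↦ by simp [LieHom.lie_apply, ha.1], fun r hr ↦ by
        rw [LieHom.lie_apply, ha.2 r hr, ha.2 ⁅x, r⁆ (by simp [hr]), lie_zero, sub_zero]⟩ }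
  let P : LieSubmodule F L N :=
    { carrier := {φ | ∃ r, π r = 0 ∧ ∀ y, (φ : L →ₗ[F] L) y = ⁅r, y⁆}
      add_mem' := by
        rintro a b ⟨r, hr, ha⟩ ⟨t, ht, hb⟩
        exact ⟨r + t, by simp [hr, ht], fun y ↦ by simp [ha, hb]⟩
      zero_mem' := ⟨0, by simp⟩
      smul_mem' := by
        rintro c a ⟨r, hr, ha⟩
        exact ⟨c • r, by simp [hr], fun y ↦ by simp [ha]⟩
      lie_mem := by
        rintro x a ⟨r, hr, ha⟩
        refine ⟨⁅x, r⁆, by simp [hr], fun y ↦ ?_⟩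
        rw [LieSubmodule.coe_bracket, LieHom.lie_apply, ha, ha, lie_lie] }
  obtain ⟨p, hp⟩ := (LinearMap.ker (π : L →ₗ[F] g)).subtype.exists_leftInverse_of_injective
    (Submodule.ker_subtype _)
  let φ₀ : L →ₗ[F] L := (LinearMap.ker (π : L →ₗ[F] g)).subtype ∘ₗ p
  have h₀ (x : L) : π (φ₀ x) = 0 := (p x).2
  have h₁ (r : L) (hr : π r = 0) : φ₀ r = r := congrArg Subtype.val (LinearMap.congr_fun hp ⟨r, hr⟩)
  let f₀ : L →ₗ[F] N := LinearMap.codRestrict N.toSubmodule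
    ((toEnd F L (L →ₗ[F] L) : L →ₗ[F] Module.End F (L →ₗ[F] L)).flip φ₀) fun x ↦
      ⟨fun y ↦ by
        change π (⁅x, φ₀⁆ y) = 0
        simp [LieHom.lie_apply, h₀], fun r hr ↦ by
        change ⁅x, φ₀⁆ r = 0
        rw [LieHom.lie_apply, h₁ r hr, h₁ ⁅x, r⁆ (by simp [hr]), sub_self]⟩
  have hf₀ (x : L) : (f₀ x : L →ₗ[F] L) = ⁅x, φ₀⁆ := rfl
  have hfin : FiniteDimensional F (N ⧸ P) :=
    inferInstanceAs (FiniteDimensional F (N ⧸ P.toSubmodule))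
  obtain ⟨q, hq⟩ := exists_lie_eq_of_cocycle_of_surjective (V := N ⧸ P) π hπ
    (fun x hx v ↦ by
      obtain ⟨ψ, rfl⟩ := LieSubmodule.Quotient.surjective_mk' P v
      rw [← LieModuleHom.map_lie]
      suffices ⁅x, ψ⁆ = 0 by rw [this, map_zero]
      refine Subtype.ext (LinearMap.ext fun y ↦ ?_)
      rw [LieSubmodule.coe_bracket, LieHom.lie_apply, hab x _ hx (ψ.2.1 y),
        ψ.2.2 ⁅x, y⁆ (by simp [hx])]
      simp)
    ((LieSubmodule.Quotient.mk' P : N →ₗ[F] N ⧸ P) ∘ₗ f₀)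
    (fun x y ↦ by
      have : f₀ ⁅x, y⁆ = ⁅x, f₀ y⁆ - ⁅y, f₀ x⁆ := Subtype.ext (by
        simp only [hf₀, LieSubmodule.coe_sub, LieSubmodule.coe_bracket, lie_lie])
      simp only [LinearMap.comp_apply, this, LieModuleHom.coe_toLinearMap, map_sub,
        LieModuleHom.map_lie])
    (fun x hx ↦ by
      rw [LinearMap.comp_apply, LieModuleHom.coe_toLinearMap, LieSubmodule.Quotient.mk_eq_zero]
      -- For `x ∈ ker π`, `[x, φ₀] = -ad x`, so the cocycle vanishes on the kernel only modulo `P`.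
      refine ⟨-x, by simp [hx], fun y ↦ ?_⟩
      rw [hf₀, LieHom.lie_apply, hab x _ hx (h₀ y), h₁ ⁅x, y⁆ (by simp [hx]), zero_sub, neg_lie])
  obtain ⟨ψ, rfl⟩ := LieSubmodule.Quotient.surjective_mk' P q
  refine ⟨φ₀ - ψ, fun x ↦ by simp [h₀, ψ.2.1 x], fun r hr ↦ by simp [h₁ r hr, ψ.2.2 r hr],
    fun x ↦ ?_⟩
  have hx : f₀ x - ⁅x, ψ⁆ ∈ P := by
    rw [← LieSubmodule.Quotient.mk_eq_zero, map_sub, LieModuleHom.map_lie, ← hq x]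
    simp
  obtain ⟨r, hr, h⟩ := hx
  refine ⟨r, hr, fun y ↦ ?_⟩
  rw [← h y, LieSubmodule.coe_sub, LieSubmodule.coe_bracket, hf₀]
  simp only [LinearMap.sub_apply, LieHom.lie_apply, lie_sub]
  abel

/-- Levi's theorem: a surjection onto a semisimple Lie algebra with solvable kernel splits. -/
theorem exists_lieHom_section (π : L →ₗ⁅F⁆ g) (hπ : Function.Surjective π)
    (hsol : IsSolvable π.ker) : ∃ σ : g →ₗ⁅F⁆ L, ∀ y, π (σ y) = y := by
  induction hd : Module.finrank F L using Nat.strong_induction_on generalizing L with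
  | _ d ih =>
  -- A proper subalgebra that still surjects onto `g` reduces the dimension.
  have sub (S : LieSubalgebra F L) (hS : S ≠ ⊤) (hsurj : ∀ y, ∃ x ∈ S, π x = y) :
      ∃ σ : g →ₗ⁅F⁆ L, ∀ y, π (σ y) = y := by
    have hlt : Module.finrank F S < d :=
      hd ▸ Submodule.finrank_lt (s := S.toSubmodule) (by simpa using hS)
    let j : (π.comp S.incl).ker →ₗ⁅F⁆ π.ker :=
      { toFun := fun x ↦ ⟨(x : S), x.2⟩
        map_add' := fun _ _ ↦ rfl
        map_smul' := fun _ _ ↦ rfl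
        map_lie' := rfl }
    have hj : Function.Injective j := fun x y hxy ↦
      Subtype.ext (Subtype.ext (congrArg (fun w : π.ker ↦ (w : L)) hxy))
    obtain ⟨σ, hσ⟩ := ih _ hlt (π.comp S.incl)
      (fun y ↦ by obtain ⟨x, hx, rfl⟩ := hsurj y; exact ⟨⟨x, hx⟩, rfl⟩)
      hj.lieAlgebra_isSolvable rfl
    exact ⟨S.incl.comp σ, hσ⟩
  by_cases hD : ⁅π.ker, π.ker⁆ = ⊥
  · have hab (x y : L) (hx : π x = 0) (hy : π y = 0) : ⁅x, y⁆ = 0 :=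
      (LieSubmodule.lie_eq_bot_iff _ _).mp hD x hx y hy
    obtain ⟨φ, hφ, hφid, hr⟩ := exists_projection_lie_eq_inner π hπ hab
    -- `S` is the stabilizer of the projection `φ`. It surjects onto `g`, because `x + r` stabilizes
    -- `φ` for a suitable `r ∈ ker π`. If `S = L`, then `ker φ` is an ideal complementing `ker π`.
    let S : LieSubalgebra F L :=
      { carrier := {x | ∀ y, ⁅x, φ y⁆ = φ ⁅x, y⁆}
        add_mem' := fun ha hb y ↦ by simp [ha y, hb y]
        zero_mem' := by simp
        smul_mem' := fun c a ha y ↦ by simp [ha y]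
        lie_mem' := fun {a b} ha hb y ↦ by
          rw [lie_lie, lie_lie, hb y, ha y, ha, hb, map_sub] }
    by_cases hS : S = ⊤
    · have hc (x y : L) : ⁅x, φ y⁆ = φ ⁅x, y⁆ := by
        have : x ∈ S := by rw [hS]; trivial
        exact this y
      obtain ⟨s, hs⟩ := (π : L →ₗ[F] g).exists_rightInverse_of_surjective
        (LinearMap.range_eq_top.mpr hπ)
      replace hs (y : g) : π (s y) = y := LinearMap.congr_fun hs y
      let τ : g →ₗ[F] L := s - φ ∘ₗ s
      have hτ (y : g) : π (τ y) = y := by simp [τ, hs, hφ]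
      have hφτ (y : g) : φ (τ y) = 0 := by simp [τ, hφid _ (hφ _)]
      refine ⟨{ τ with map_lie' := fun {x y} ↦ ?_ }, hτ⟩
      change τ ⁅x, y⁆ = ⁅τ x, τ y⁆
      rw [← sub_eq_zero, ← hφid (τ ⁅x, y⁆ - ⁅τ x, τ y⁆) (by simp [hτ]), map_sub, hφτ, ← hc, hφτ]
      simp
    · refine sub S hS fun y ↦ ?_
      obtain ⟨x, rfl⟩ := hπ y
      obtain ⟨r, hr0, hr⟩ := hr x
      refine ⟨x + r, fun y ↦ ?_, by simp [hr0]⟩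
      rw [add_lie, add_lie, map_add, hab r _ hr0 (hφ y), hφid ⁅r, y⁆ (by simp [hr0]), ← hr]
      abel
  · set D : LieIdeal F L := ⁅π.ker, π.ker⁆ with hDdef
    have hDker : D ≤ π.ker := LieSubmodule.lie_le_right _ _
    let π' : (L ⧸ D) →ₗ⁅F⁆ g :=
      { D.toSubmodule.liftQ (π : L →ₗ[F] g) hDker with
        map_lie' := fun {x y} ↦ by
          obtain ⟨x, rfl⟩ := LieSubmodule.Quotient.surjective_mk' D x
          obtain ⟨y, rfl⟩ := LieSubmodule.Quotient.surjective_mk' D y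
          exact LieHom.map_lie π x y }
    let m : L → L ⧸ D := LieSubmodule.Quotient.mk
    have hm : Function.Surjective m := LieSubmodule.Quotient.surjective_mk' D
    have hm0 (x : L) : m x = 0 ↔ x ∈ D := LieSubmodule.Quotient.mk_eq_zero D
    have hπ' (x : L) : π' (m x) = π x := rfl
    have hfin : FiniteDimensional F (L ⧸ D) :=
      inferInstanceAs (FiniteDimensional F (L ⧸ D.toSubmodule))
    have hlt : Module.finrank F (L ⧸ D) < d := by
      have hsum := Submodule.finrank_quotient_add_finrank D.toSubmodule
      have hpos : 0 < Module.finrank F D.toSubmodule := by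
        have := (LieSubmodule.nontrivial_iff_ne_bot F L L).mpr hD
        exact Module.finrank_pos (R := F) (M := D)
      change Module.finrank F (L ⧸ D.toSubmodule) < d
      omega
    let j : π.ker →ₗ⁅F⁆ π'.ker :=
      { toFun := fun x ↦ ⟨m x, x.2⟩
        map_add' := fun _ _ ↦ rfl
        map_smul' := fun _ _ ↦ rfl
        map_lie' := rfl }
    have hj : Function.Surjective j := by
      rintro ⟨x, hx⟩
      obtain ⟨x, rfl⟩ := hm x
      exact ⟨⟨x, hx⟩, rfl⟩
    obtain ⟨σ', hσ'⟩ := ih _ hlt π' (fun y ↦ by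
      obtain ⟨x, rfl⟩ := hπ y; exact ⟨m x, rfl⟩) hj.lieAlgebra_isSolvable rfl
    -- The preimage of the section of `L / D → g`. It is proper: otherwise `ker π = D = [ker π, ker
    -- π]`, so the solvable kernel would vanish.
    let S : LieSubalgebra F L :=
      { carrier := {x | m x = σ' (π x)}
        add_mem' := fun {a b} ha hb ↦ by
          change m a + m b = _
          rw [ha, hb, map_add, map_add]
        zero_mem' := by
          change (0 : L ⧸ D) = _
          simp
        smul_mem' := fun c a ha ↦ by
          change c • m a = _
          rw [ha, map_smul, map_smul]
        lie_mem' := fun {a b} ha hb ↦ by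
          change ⁅m a, m b⁆ = _
          rw [ha, hb, LieHom.map_lie, LieHom.map_lie] }
    refine sub S (fun hS ↦ hD ?_) fun y ↦ ?_
    · have hker : D = π.ker := le_antisymm hDker fun x hx ↦ by
        have hxS : x ∈ S := by rw [hS]; trivial
        have hx0 : m x = σ' (π x) := hxS
        rw [LieHom.mem_ker.mp hx, map_zero] at hx0
        exact (hm0 x).mp hx0
      obtain ⟨k, hk⟩ := IsSolvable.solvable F π.ker
      rw [LieIdeal.derivedSeries_eq_bot_iff] at hk
      have hall (k : ℕ) : derivedSeriesOfIdeal F L k π.ker = π.ker := by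
        induction k with
        | zero => rfl
        | succ k ih => rw [derivedSeriesOfIdeal_succ, ih, ← hDdef, hker]
      rw [hker, ← hall k, hk]
    · obtain ⟨x, hx⟩ := hm (σ' y)
      have hxy : π x = y := by rw [← hπ', hx, hσ']
      exact ⟨x, by change m x = σ' (π x); rw [hx, hxy], hxy⟩

end Levi

/-! ### The Jacobson radical, Levi factors and centralizers. -/

section Radical

open LieAlgebra LieModule

variable {F L : Type*} [Field F] [LieRing L] [LieAlgebra F L]

/-- The quotient map by an ideal, as a morphism of Lie algebras. -/
def LieIdeal.quotientHom (I : LieIdeal F L) : L →ₗ⁅F⁆ L ⧸ I :=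
  { (LieSubmodule.Quotient.mk' I : L →ₗ[F] L ⧸ I) with map_lie' := rfl }

theorem LieIdeal.quotientHom_surjective (I : LieIdeal F L) :
    Function.Surjective I.quotientHom :=
  LieSubmodule.Quotient.surjective_mk' I

theorem LieIdeal.quotientHom_eq_zero (I : LieIdeal F L) {x : L} :
    I.quotientHom x = 0 ↔ x ∈ I :=
  LieSubmodule.Quotient.mk_eq_zero I

theorem LieIdeal.ker_quotientHom (I : LieIdeal F L) : I.quotientHom.ker = I := by
  ext x
  rw [LieHom.mem_ker, I.quotientHom_eq_zero]

theorem isCoatom_comap_of_surjective {L' : Type*} [LieRing L'] [LieAlgebra F L']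
    (π : L →ₗ⁅F⁆ L') (hπ : Function.Surjective π) {B : LieIdeal F L'} (hB : IsCoatom B) :
    IsCoatom (B.comap π) := by
  refine ⟨fun h ↦ hB.1 ?_, fun K hK ↦ ?_⟩
  · rw [eq_top_iff]
    intro y _
    obtain ⟨x, rfl⟩ := hπ y
    have hx : x ∈ B.comap π := by rw [h]; trivial
    exact hx
  · have hle : B ≤ K.map π := fun y hy ↦ by
      obtain ⟨x, rfl⟩ := hπ y
      exact LieIdeal.mem_map (hK.le hy)
    have hlt : B < K.map π := lt_of_le_of_ne hle fun h ↦
      hK.not_ge (LieIdeal.map_le_iff_le_comap.mp h.ge)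
    have htop := hB.2 _ hlt
    rw [eq_top_iff]
    intro x _
    have hx : π x ∈ K.map π := by rw [htop]; trivial
    obtain ⟨y, hy⟩ := LieIdeal.mem_map_of_surjective hπ hx
    have hd : x - (y : L) ∈ K := hK.le (by
      rw [LieIdeal.mem_comap, map_sub, hy, sub_self]
      exact zero_mem B)
    simpa using add_mem hd y.2

theorem derivedSeriesOfIdeal_le_sup {I J K : LieIdeal F L} (h : K ≤ I ⊔ J) (k : ℕ) :
    derivedSeriesOfIdeal F L k K ≤ I ⊔ derivedSeriesOfIdeal F L k J := by
  induction k with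
  | zero => exact h
  | succ k ih =>
    rw [derivedSeriesOfIdeal_succ, derivedSeriesOfIdeal_succ]
    refine (LieSubmodule.mono_lie ih ih).trans ?_
    rw [LieSubmodule.sup_lie]
    refine sup_le ((LieSubmodule.lie_le_left I _).trans le_sup_left) ?_
    rw [LieSubmodule.lie_sup]
    exact sup_le_sup (LieSubmodule.lie_le_right I _) le_rfl

/-- The hypothesis says that `L / I` is perfect, so its derived series is constant. -/
theorem sup_derivedSeries_eq_top {I : LieIdeal F L} (h : I ⊔ derivedSeries F L 1 = ⊤) (k : ℕ) :
    I ⊔ derivedSeries F L k = ⊤ := by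
  induction k with
  | zero => rw [derivedSeries_def, derivedSeriesOfIdeal_zero, sup_top_eq]
  | succ k ih =>
    rw [eq_top_iff, ← h]
    refine sup_le le_sup_left ?_
    have := derivedSeriesOfIdeal_le_sup ih.ge 1
    rwa [derivedSeries_def F L k, ← derivedSeriesOfIdeal_add, add_comm 1 k] at this

/-- Otherwise the nonzero quotient `L / I` would be perfect and also an image of the radical, hence
solvable. -/
theorem radical_le_of_isCoatom [FiniteDimensional F L] {I : LieIdeal F L} (hI : IsCoatom I)
    (hD : ¬ ⁅(⊤ : LieIdeal F L), (⊤ : LieIdeal F L)⁆ ≤ I) : radical F L ≤ I := by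
  by_contra hR
  have h1 : I ⊔ derivedSeries F L 1 = ⊤ := hI.2 _ (left_lt_sup.mpr hD)
  have h2 : I ⊔ radical F L = ⊤ := hI.2 _ (left_lt_sup.mpr hR)
  obtain ⟨k, hk⟩ := IsSolvable.solvable F (radical F L)
  rw [LieIdeal.derivedSeries_eq_bot_iff] at hk
  have h3 := derivedSeriesOfIdeal_le_sup h2.ge k
  rw [hk, sup_bot_eq] at h3
  have h4 := sup_derivedSeries_eq_top h1 k
  rw [derivedSeries_def, sup_eq_left.mpr h3] at h4
  exact hI.1 h4

theorem hasTrivialRadical_quotient_radical [FiniteDimensional F L] :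
    HasTrivialRadical F (L ⧸ radical F L) := by
  set π := (radical F L).quotientHom
  have hπ : Function.Surjective π := (radical F L).quotientHom_surjective
  rw [hasTrivialRadical_iff_no_abelian_ideals]
  intro K hK
  rw [LieSubmodule.lie_abelian_iff_lie_self_eq_bot] at hK
  have h1 : derivedSeriesOfIdeal F L 1 (K.comap π) ≤ radical F L := by
    rw [derivedSeriesOfIdeal_succ, derivedSeriesOfIdeal_zero, LieSubmodule.lie_le_iff]
    intro x hx y hy
    rw [← (radical F L).quotientHom_eq_zero, LieHom.map_lie]
    exact (LieSubmodule.lie_eq_bot_iff _ _).mp hK _ hx _ hy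
  obtain ⟨k, hk⟩ := IsSolvable.solvable F (radical F L)
  rw [LieIdeal.derivedSeries_eq_bot_iff] at hk
  have h2 : IsSolvable (K.comap π) := by
    refine IsSolvable.mk (R := F) (k := k + 1) ?_
    rw [LieIdeal.derivedSeries_eq_bot_iff, derivedSeriesOfIdeal_add, eq_bot_iff, ← hk]
    exact derivedSeriesOfIdeal_mono h1 k
  rw [LieIdeal.solvable_iff_le_radical] at h2
  rw [eq_bot_iff]
  intro y hy
  obtain ⟨x, rfl⟩ := hπ y
  rw [LieSubmodule.mem_bot]
  exact (radical F L).quotientHom_eq_zero.mpr (h2 hy)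

/-- Every hyperplane containing `[L, L]` is a maximal ideal, and hyperplanes separate points from
`[L, L]`. -/
theorem lieJacobson_le_derived :
    lieJacobson F L ≤ ⁅(⊤ : LieIdeal F L), (⊤ : LieIdeal F L)⁆ := by
  intro x hx
  by_contra hxD
  obtain ⟨φ, hφx, hφ⟩ := Submodule.exists_dual_map_eq_bot_of_notMem (R := F)
    (p := (⁅(⊤ : LieIdeal F L), (⊤ : LieIdeal F L)⁆ : LieIdeal F L).toSubmodule) hxD inferInstance
  replace hφ : ∀ y ∈ ⁅(⊤ : LieIdeal F L), (⊤ : LieIdeal F L)⁆, φ y = 0 := fun y hy ↦ by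
    have : φ y ∈ Submodule.map φ
      (⁅(⊤ : LieIdeal F L), (⊤ : LieIdeal F L)⁆ : LieIdeal F L).toSubmodule := ⟨y, hy, rfl⟩
    rwa [hφ, Submodule.mem_bot] at this
  let H : LieIdeal F L :=
    { LinearMap.ker φ with
      lie_mem := fun {a b} _ ↦ hφ _ (LieSubmodule.lie_mem_lie trivial trivial) }
  have hH (y : L) : y ∈ H ↔ φ y = 0 := Iff.rfl
  have hcoatom : IsCoatom H := by
    refine ⟨fun h ↦ hφx ((hH x).mp (by rw [h]; trivial)), fun K hK ↦ ?_⟩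
    obtain ⟨w, hwK, hwH⟩ := SetLike.exists_of_lt hK
    rw [hH] at hwH
    rw [eq_top_iff]
    intro y _
    have hy : y - (φ y / φ w) • w ∈ H := by
      rw [hH]; simp [hwH]
    simpa using add_mem (hK.le hy) (K.smul_mem (φ y / φ w) hwK)
  exact hφx ((hH x).mp (sInf_le (a := H) hcoatom hx))

variable [CharZero F]

/-- A minimal ideal inside `𝒥(L)` would lie in its own Killing complement, which is a maximal ideal.
-/
theorem lieJacobson_eq_bot_of_hasTrivialRadical [FiniteDimensional F L] [HasTrivialRadical F L] :
    lieJacobson F L = ⊥ := by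
  refine (eq_bot_or_exists_atom_le (lieJacobson F L)).resolve_right ?_
  rintro ⟨A, hA, hle⟩
  have hc := A.isCompl_killingCompl
  have hco : IsCoatom A.killingCompl := hc.isAtom_iff_isCoatom.mp hA
  exact hA.1 (by
    rw [← hc.inf_eq_bot, left_eq_inf]
    exact hle.trans (sInf_le hco))

theorem lieJacobson_le_radical [FiniteDimensional F L] : lieJacobson F L ≤ radical F L := by
  intro x hx
  set π := (radical F L).quotientHom
  have hπ : Function.Surjective π := (radical F L).quotientHom_surjective
  have := hasTrivialRadical_quotient_radical (F := F) (L := L)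
  have hfin : FiniteDimensional F (L ⧸ radical F L) :=
    inferInstanceAs (FiniteDimensional F (L ⧸ (radical F L).toSubmodule))
  have h0 : π x ∈ lieJacobson F (L ⧸ radical F L) := by
    rw [lieJacobson, ← SetLike.mem_coe, LieSubmodule.coe_sInf]
    refine Set.mem_iInter₂.mpr fun B hB ↦ ?_
    have hle : lieJacobson F L ≤ LieIdeal.comap π B :=
      sInf_le (isCoatom_comap_of_surjective π hπ hB)
    exact hle hx
  rw [lieJacobson_eq_bot_of_hasTrivialRadical, LieSubmodule.mem_bot] at h0
  exact (radical F L).quotientHom_eq_zero.mp h0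

/-- The Jacobson radical in characteristic zero is `[L, L] ∩ Rad L`. -/
theorem lieJacobson_eq_inf_radical [FiniteDimensional F L] :
    lieJacobson F L = ⁅(⊤ : LieIdeal F L), (⊤ : LieIdeal F L)⁆ ⊓ radical F L := by
  apply le_antisymm
  · exact le_inf lieJacobson_le_derived lieJacobson_le_radical
  · refine le_sInf fun I hI ↦ ?_
    by_cases hD : ⁅(⊤ : LieIdeal F L), (⊤ : LieIdeal F L)⁆ ≤ I
    · exact inf_le_left.trans hD
    · exact inf_le_right.trans (radical_le_of_isCoatom hI hD)

theorem lieJacobson_eq_radical_of_perfect [FiniteDimensional F L]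
    (h : ⁅(⊤ : LieIdeal F L), (⊤ : LieIdeal F L)⁆ = ⊤) : lieJacobson F L = radical F L := by
  rw [lieJacobson_eq_inf_radical, h, top_inf_eq]

/-- Levi's theorem. -/
theorem exists_isLeviFactor [FiniteDimensional F L] :
    ∃ S : LieSubalgebra F L, IsLeviFactor S := by
  set π := (radical F L).quotientHom with hπdef
  have := hasTrivialRadical_quotient_radical (F := F) (L := L)
  have hfin : FiniteDimensional F (L ⧸ radical F L) :=
    inferInstanceAs (FiniteDimensional F (L ⧸ (radical F L).toSubmodule))
  obtain ⟨σ, hσ⟩ := exists_lieHom_section π (radical F L).quotientHom_surjective (by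
    rw [hπdef, LieIdeal.ker_quotientHom]; infer_instance)
  have hinj : Function.Injective σ := Function.LeftInverse.injective hσ
  refine ⟨σ.range, ?_, ?_, ?_⟩
  · have := (LieEquiv.ofInjective σ hinj).isKilling
    infer_instance
  · rw [Submodule.disjoint_def]
    rintro _ ⟨y, rfl⟩ hy
    have := (radical F L).quotientHom_eq_zero.mpr hy
    have h0 : y = 0 := (hσ y).symm.trans this
    rw [h0]; simp
  · rw [codisjoint_iff, eq_top_iff]
    intro x _
    refine Submodule.mem_sup.mpr ⟨σ (π x), ⟨π x, rfl⟩, x - σ (π x), ?_, by abel⟩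
    change x - σ (π x) ∈ radical F L
    rw [← (radical F L).quotientHom_eq_zero]
    change π _ = 0
    rw [map_sub, hσ, sub_self]

/-- An element that is central modulo an ideal `I` can be moved, modulo `I`, into the radical and
into the centralizer of a given Levi factor. -/
theorem exists_mem_radical_centralizer_of_central_mod [FiniteDimensional F L]
    {S : LieSubalgebra F L} (hS : IsLeviFactor S) (I : LieIdeal F L) (m : L)
    (hm : ∀ y : L, ⁅y, m⁆ ∈ I) :
    ∃ x ∈ radical F L, (∀ s ∈ S, ⁅s, x⁆ = 0) ∧ m - x ∈ I := by
  -- In the semisimple quotient `L / Rad L`, the component of `m` off the image of `I` is central,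
  -- hence zero.
  obtain ⟨i, hi, hmi⟩ : ∃ i ∈ I, m - i ∈ radical F L := by
    set π := (radical F L).quotientHom
    have hπ : Function.Surjective π := (radical F L).quotientHom_surjective
    have := hasTrivialRadical_quotient_radical (F := F) (L := L)
    have hfin : FiniteDimensional F (L ⧸ radical F L) :=
      inferInstanceAs (FiniteDimensional F (L ⧸ (radical F L).toSubmodule))
    have hc := (I.map π).isCompl_killingCompl
    have hmem : π m ∈ I.map π ⊔ (I.map π).killingCompl := by rw [hc.sup_eq_top]; trivial
    obtain ⟨a, ha, b, hb, hab⟩ := (LieSubmodule.mem_sup _ _ _).mp hmem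
    have hb0 : b ∈ LieAlgebra.center F (L ⧸ radical F L) := fun y ↦ by
      obtain ⟨y, rfl⟩ := hπ y
      have h1 : ⁅π y, b⁆ ∈ I.map π ⊓ (I.map π).killingCompl := by
        refine ⟨?_, lie_mem_right F _ _ _ _ hb⟩
        have : ⁅π y, b⁆ = π ⁅y, m⁆ - ⁅π y, a⁆ := by
          rw [LieHom.map_lie, ← hab, lie_add, add_sub_cancel_left]
        change ⁅π y, b⁆ ∈ I.map π
        rw [this]
        exact sub_mem (LieIdeal.mem_map (hm y)) (lie_mem_right F _ _ _ _ ha)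
      rwa [hc.inf_eq_bot, LieSubmodule.mem_bot] at h1
    rw [center_eq_bot, LieSubmodule.mem_bot] at hb0
    rw [hb0, add_zero] at hab
    rw [hab] at ha
    obtain ⟨i, hi⟩ := LieIdeal.mem_map_of_surjective hπ ha
    refine ⟨i, i.2, ?_⟩
    rw [← (radical F L).quotientHom_eq_zero]
    change π _ = 0
    rw [map_sub, hi, sub_self]
  set r := m - i
  have := hS.semisimple
  have hmem (s : S) : ⁅(s : L), r⁆ ∈ I ⊓ radical F L :=
    ⟨by rw [lie_sub]; exact sub_mem (hm _) (lie_mem_right F _ _ _ _ hi),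
      lie_mem_right F _ _ _ _ hmi⟩
  -- Whitehead's lemma for the cocycle `s ↦ [s, r]` in `I ∩ Rad L` gives `v` there with `r - v`
  -- centralizing `S`.
  let f : S →ₗ[F] (I ⊓ radical F L : LieIdeal F L) :=
    LinearMap.codRestrict (I ⊓ radical F L : LieIdeal F L).toSubmodule
      ((toEnd F S L : S →ₗ[F] Module.End F L).flip r) hmem
  have hf (s : S) : (f s : L) = ⁅(s : L), r⁆ := rfl
  obtain ⟨v, hv⟩ := exists_lie_eq_of_cocycle f fun s t ↦ Subtype.ext (by
    change ⁅⁅(s : L), (t : L)⁆, r⁆ = ⁅(s : L), ⁅(t : L), r⁆⁆ - ⁅(t : L), ⁅(s : L), r⁆⁆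
    rw [lie_lie])
  refine ⟨r - v, sub_mem hmi v.2.2, fun s hs ↦ ?_, ?_⟩
  · have h1 : ⁅s, r⁆ = ⁅s, (v : L)⁆ := congrArg Subtype.val (hv ⟨s, hs⟩)
    rw [lie_sub, h1, sub_self]
  · have : m - (r - v) = i + v := by simp only [r]; abel
    rw [this]
    exact add_mem hi v.2.1

end Radical

/-! ### Subspaces and ideals of `M ⊕ Fz`. -/

section Subspaces

open LieAlgebra

variable {F L : Type*} [Field F] [LieRing L] [LieAlgebra F L] {M : LieIdeal F L} {z : L}

theorem mem_subspaceIn {V : Submodule F M} {x : L} :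
    x ∈ subspaceIn M V ↔ ∃ y ∈ V, (y : L) = x := Iff.rfl

theorem coe_mem_subspaceIn {V : Submodule F M} {y : M} : (y : L) ∈ subspaceIn M V ↔ y ∈ V := by
  rw [mem_subspaceIn]
  exact ⟨fun ⟨_, h, e⟩ ↦ Subtype.ext e ▸ h, fun h ↦ ⟨y, h, rfl⟩⟩

theorem lie_top_eq_top_of_lie_self_eq (hM : ⁅M, M⁆ = M) :
    ⁅(⊤ : LieIdeal F M), (⊤ : LieIdeal F M)⁆ = ⊤ := by
  have := LieIdeal.comap_bracket_incl (I := M) (I₁ := M) (I₂ := M)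
  rwa [LieIdeal.comap_incl_self, inf_idem, hM, LieIdeal.comap_incl_self] at this

theorem eq_bot_of_isSolvable_of_lie_self_eq (hM : ⁅M, M⁆ = M) (h : IsSolvable M) : M = ⊥ := by
  obtain ⟨k, hk⟩ := IsSolvable.solvable F M
  rw [LieIdeal.derivedSeries_eq_bot_iff] at hk
  have hall (k : ℕ) : derivedSeriesOfIdeal F L k M = M := by
    induction k with
    | zero => rfl
    | succ k ih => rw [derivedSeriesOfIdeal_succ, ih, hM]
  rw [← hall k, hk]

theorem exists_eq_add_smul (hL : IsCompl M.toSubmodule (Submodule.span F {z})) (y : L) :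
    ∃ (m : M) (c : F), y = m + c • z := by
  have hy : y ∈ M.toSubmodule ⊔ Submodule.span F {z} := by rw [hL.sup_eq_top]; trivial
  obtain ⟨m, hm, w, hw, rfl⟩ := Submodule.mem_sup.mp hy
  obtain ⟨c, rfl⟩ := Submodule.mem_span_singleton.mp hw
  exact ⟨⟨m, hm⟩, c, rfl⟩

theorem smul_mem_iff_eq_zero (hz : z ≠ 0)
    (hL : IsCompl M.toSubmodule (Submodule.span F {z})) {c : F} : c • z ∈ M ↔ c = 0 := by
  refine ⟨fun h ↦ ?_, fun h ↦ by simp [h]⟩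
  have h0 := Submodule.disjoint_def.mp hL.disjoint _ h
    (Submodule.smul_mem _ c (Submodule.mem_span_singleton_self z))
  exact (smul_eq_zero.mp h0).resolve_right hz

theorem add_smul_add_mem_iff_eq_zero (hz : z ≠ 0)
    (hL : IsCompl M.toSubmodule (Submodule.span F {z})) (x : M) {c : F} :
    c • ((x : L) + z) ∈ M ↔ c = 0 := by
  rw [← smul_mem_iff_eq_zero hz hL, smul_add]
  exact ⟨fun h ↦ by simpa using sub_mem h (M.smul_mem c x.2),
    fun h ↦ add_mem (M.smul_mem c x.2) h⟩

theorem disjoint_subspaceIn_span (hz : z ≠ 0)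
    (hL : IsCompl M.toSubmodule (Submodule.span F {z})) (V : Submodule F M) (x : M) :
    Disjoint (subspaceIn M V) (Submodule.span F {(x : L) + z}) := by
  rw [Submodule.disjoint_def]
  rintro _ ⟨y, -, rfl⟩ hy
  obtain ⟨c, hc⟩ := Submodule.mem_span_singleton.mp hy
  have h0 := (add_smul_add_mem_iff_eq_zero hz hL x).mp (hc ▸ y.2 : c • ((x : L) + z) ∈ M)
  rw [← hc, h0, zero_smul]

theorem lie_add_smul_of_mem_center (hzc : z ∈ LieAlgebra.center F L) (x : L) (c : F) (y : L) :
    ⁅x + c • z, y⁆ = ⁅x, y⁆ := by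
  have : ⁅y, z⁆ = 0 := hzc y
  rw [add_lie, smul_lie, ← lie_skew z, this]
  simp

theorem isLieIdeal_of_forall_lie_mem {V : Submodule F L}
    (hL : IsCompl M.toSubmodule (Submodule.span F {z})) (hzc : z ∈ LieAlgebra.center F L)
    (h : ∀ (m : M), ∀ v ∈ V, ⁅(m : L), v⁆ ∈ V) : IsLieIdeal V := by
  refine ⟨{ V with lie_mem := fun {x v} hv ↦ ?_ }, rfl⟩
  obtain ⟨m, c, rfl⟩ := exists_eq_add_smul hL x
  rw [lie_add_smul_of_mem_center hzc]
  exact h m v hv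

theorem isLieIdeal_subspaceIn (hL : IsCompl M.toSubmodule (Submodule.span F {z}))
    (hzc : z ∈ LieAlgebra.center F L) (I : LieIdeal F M) :
    IsLieIdeal (subspaceIn M I.toSubmodule) :=
  isLieIdeal_of_forall_lie_mem hL hzc (by
    rintro m _ ⟨y, hy, rfl⟩
    exact ⟨⁅m, y⁆, lie_mem_right F M I m y hy, rfl⟩)

theorem isLieIdeal_shiftedIdeal (hL : IsCompl M.toSubmodule (Submodule.span F {z}))
    (hzc : z ∈ LieAlgebra.center F L) (I : LieIdeal F M) (x : M) (hx : ∀ m : M, ⁅m, x⁆ ∈ I) :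
    IsLieIdeal (shiftedIdeal M z I x) :=
  isLieIdeal_of_forall_lie_mem hL hzc fun m v hv ↦ by
    obtain ⟨_, ⟨y, hy, rfl⟩, w, hw, rfl⟩ := Submodule.mem_sup.mp hv
    obtain ⟨c, rfl⟩ := Submodule.mem_span_singleton.mp hw
    refine Submodule.mem_sup_left ⟨⁅m, y + c • x⁆, ?_, ?_⟩
    · rw [lie_add, lie_smul]
      exact add_mem (lie_mem_right F M I m y hy) (I.smul_mem c (hx m))
    · have : ⁅(m : L), z⁆ = 0 := hzc m
      change ⁅(m : L), (y : L) + c • (x : L)⁆ = ⁅(m : L), (y : L) + c • ((x : L) + z)⁆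
      simp [lie_add, this]

theorem derived_eq_of_isCompl (hM : ⁅M, M⁆ = M)
    (hL : IsCompl M.toSubmodule (Submodule.span F {z})) (hzc : z ∈ LieAlgebra.center F L) :
    ⁅(⊤ : LieIdeal F L), (⊤ : LieIdeal F L)⁆ = M := by
  refine le_antisymm ?_ (hM.ge.trans (LieSubmodule.mono_lie le_top le_top))
  rw [LieSubmodule.lie_le_iff]
  intro x _ y _
  obtain ⟨m, c, rfl⟩ := exists_eq_add_smul hL x
  rw [lie_add_smul_of_mem_center hzc]
  exact lie_mem_left F L M _ _ m.2

/-- `Rad L ∩ M` is a solvable ideal of `M`; conversely `Rad M` is an ideal of `L` because `z` acts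
by zero. -/
theorem coe_mem_radical_iff [FiniteDimensional F L]
    (hL : IsCompl M.toSubmodule (Submodule.span F {z})) (hzc : z ∈ LieAlgebra.center F L)
    (x : M) : (x : L) ∈ radical F L ↔ x ∈ radical F M := by
  constructor
  · intro hx
    let j : LieIdeal.comap M.incl (radical F L) →ₗ⁅F⁆ radical F L :=
      { toFun := fun y ↦ ⟨((y : M) : L), y.2⟩
        map_add' := fun _ _ ↦ rfl
        map_smul' := fun _ _ ↦ rfl
        map_lie' := rfl }
    have hj : Function.Injective j := fun a b h ↦
      Subtype.ext (Subtype.ext (congrArg (fun w : radical F L ↦ (w : L)) h))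
    have := (LieIdeal.solvable_iff_le_radical F M _).mp hj.lieAlgebra_isSolvable
    exact this hx
  · intro hx
    obtain ⟨K, hK⟩ := isLieIdeal_subspaceIn hL hzc (radical F M)
    have hKmem (y : L) : y ∈ K ↔ ∃ w ∈ radical F M, (w : L) = y := by
      rw [← LieSubmodule.mem_toSubmodule, hK]; rfl
    let j : radical F M →ₗ⁅F⁆ K :=
      { toFun := fun y ↦ ⟨((y : M) : L), (hKmem _).mpr ⟨y, y.2, rfl⟩⟩
        map_add' := fun _ _ ↦ rfl
        map_smul' := fun _ _ ↦ rfl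
        map_lie' := rfl }
    have hj : Function.Surjective j := by
      rintro ⟨y, hy⟩
      obtain ⟨w, hw, rfl⟩ := (hKmem y).mp hy
      exact ⟨⟨w, hw⟩, rfl⟩
    have := (LieIdeal.solvable_iff_le_radical F L K).mp hj.lieAlgebra_isSolvable
    exact this ((hKmem _).mpr ⟨x, hx, rfl⟩)

/-- Equality puts `(α - β)x` in the common ideal, whose intersection with `M` is only `I`. -/
theorem shiftedIdeal_smul_injective (hz : z ≠ 0)
    (hL : IsCompl M.toSubmodule (Submodule.span F {z})) {I : LieIdeal F M} {x : M} (hx : x ∉ I) :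
    Function.Injective fun α : F ↦ shiftedIdeal M z I (α • x) := by
  intro α β h
  by_contra hne
  have h1 : ((α • x : M) : L) + z ∈ shiftedIdeal M z I (β • x) := by
    rw [← show shiftedIdeal M z I (α • x) = shiftedIdeal M z I (β • x) from h]
    exact Submodule.mem_sup_right (Submodule.mem_span_singleton_self _)
  have h2 : ((β • x : M) : L) + z ∈ shiftedIdeal M z I (β • x) :=
    Submodule.mem_sup_right (Submodule.mem_span_singleton_self _)
  have h3 : (((α - β) • x : M) : L) ∈ shiftedIdeal M z I (β • x) := by
    convert sub_mem h1 h2 using 1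
    rw [sub_smul, LieSubmodule.coe_sub]; abel
  obtain ⟨_, ⟨y, hy, rfl⟩, w, hw, hsum⟩ := Submodule.mem_sup.mp h3
  obtain ⟨c, rfl⟩ := Submodule.mem_span_singleton.mp hw
  replace hsum : (y : L) + c • (((β • x : M) : L) + z) = (((α - β) • x : M) : L) := hsum
  have hc : c = 0 := by
    rw [← add_smul_add_mem_iff_eq_zero hz hL (β • x), ← add_sub_cancel_left (y : L) (c • _), hsum]
    exact sub_mem ((α - β) • x).2 y.2
  rw [hc, zero_smul, add_zero] at hsum
  have hmem : (α - β) • x ∈ I := Subtype.ext hsum ▸ hy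
  apply hx
  have := I.smul_mem (α - β)⁻¹ hmem
  rwa [smul_smul, inv_mul_cancel₀ (sub_ne_zero.mpr hne), one_smul] at this

end Subspaces

/-! ### The radicals and the classification of ideals. -/

section JacobsonRadical

open LieAlgebra

variable {F L : Type*} [Field F] [CharZero F] [LieRing L] [LieAlgebra F L] [FiniteDimensional F L]
  {M : LieIdeal F L} {z : L}

theorem lieJacobson_eq_subspaceIn (hM : ⁅M, M⁆ = M)
    (hL : IsCompl M.toSubmodule (Submodule.span F {z})) (hzc : z ∈ LieAlgebra.center F L) :
    (lieJacobson F L).toSubmodule = subspaceIn M (lieJacobson F M).toSubmodule := by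
  rw [lieJacobson_eq_inf_radical, derived_eq_of_isCompl hM hL hzc,
    lieJacobson_eq_radical_of_perfect (lie_top_eq_top_of_lie_self_eq hM)]
  ext x
  constructor
  · rintro ⟨hxM, hx⟩
    exact ⟨⟨x, hxM⟩, (coe_mem_radical_iff hL hzc _).mp hx, rfl⟩
  · rintro ⟨y, hy, rfl⟩
    exact ⟨y.2, (coe_mem_radical_iff hL hzc _).mpr hy⟩

theorem isInternalSum_radical (hM : ⁅M, M⁆ = M) (hz : z ≠ 0)
    (hL : IsCompl M.toSubmodule (Submodule.span F {z})) (hzc : z ∈ LieAlgebra.center F L) :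
    IsInternalSum (radical F L).toSubmodule (Submodule.span F {z})
      (lieJacobson F L).toSubmodule := by
  have hzr : z ∈ radical F L := center_le_radical F L hzc
  refine ⟨le_antisymm (fun x hx ↦ ?_) (sup_le ?_ ?_), ?_⟩
  · obtain ⟨m, c, rfl⟩ := exists_eq_add_smul hL x
    have hm : (m : L) ∈ radical F L := by
      simpa using sub_mem (H := radical F L) hx ((radical F L).smul_mem c hzr)
    refine add_comm (m : L) (c • z) ▸ Submodule.add_mem_sup
      (Submodule.smul_mem _ c (Submodule.mem_span_singleton_self z)) ?_
    rw [lieJacobson_eq_inf_radical, derived_eq_of_isCompl hM hL hzc]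
    exact ⟨m.2, hm⟩
  · rwa [Submodule.span_singleton_le_iff_mem]
  · exact lieJacobson_le_radical
  · have := disjoint_subspaceIn_span hz hL (lieJacobson F M).toSubmodule 0
    rw [lieJacobson_eq_subspaceIn hM hL hzc]
    simpa using this.symm

theorem isInternalSum_leviFactor (hM : ⁅M, M⁆ = M)
    (hL : IsCompl M.toSubmodule (Submodule.span F {z})) (hzc : z ∈ LieAlgebra.center F L)
    {S : LieSubalgebra F M} (hS : IsLeviFactor S) :
    IsInternalSum (⁅(⊤ : LieIdeal F L), (⊤ : LieIdeal F L)⁆ : LieIdeal F L).toSubmodule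
      (subspaceIn M S.toSubmodule) (lieJacobson F L).toSubmodule := by
  rw [lieJacobson_eq_subspaceIn hM hL hzc, derived_eq_of_isCompl hM hL hzc,
    lieJacobson_eq_radical_of_perfect (lie_top_eq_top_of_lie_self_eq hM)]
  constructor
  · rw [subspaceIn, subspaceIn, ← Submodule.map_sup, hS.isCompl.sup_eq_top]
    ext x
    exact ⟨fun hx ↦ ⟨⟨x, hx⟩, trivial, rfl⟩, fun ⟨y, _, hy⟩ ↦ hy ▸ y.2⟩
  · rw [Submodule.disjoint_def]
    rintro _ ⟨s, hs, rfl⟩ hr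
    have := Submodule.disjoint_def.mp hS.isCompl.disjoint s hs (coe_mem_subspaceIn.mp hr)
    rw [this, map_zero]

/-- Perfectness gives `M = S + 𝒥(M)`: `S` kills `x`, and `𝒥(M)` sends it into `I`. Thus the pair
condition makes `x` central modulo `I`. -/
theorem IsShiftPair.lie_mem (hM : ⁅M, M⁆ = M) {S : LieSubalgebra F M} (hS : IsLeviFactor S)
    {I : LieIdeal F M} {x : M} (h : IsShiftPair S I x) (m : M) : ⁅m, x⁆ ∈ I := by
  obtain ⟨⟨-, hx⟩, -, hJ⟩ := h
  have hm : m ∈ S.toSubmodule ⊔ (radical F M).toSubmodule := by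
    rw [hS.isCompl.sup_eq_top]; trivial
  obtain ⟨s, hs, r, hr, rfl⟩ := Submodule.mem_sup.mp hm
  have h0 : ⁅s, x⁆ = 0 := hx ⟨s, hs⟩
  have hr' : r ∈ lieJacobson F M := by
    rwa [lieJacobson_eq_radical_of_perfect (lie_top_eq_top_of_lie_self_eq hM)]
  rw [add_lie, h0, zero_add, ← lie_skew]
  exact neg_mem (hJ r hr')

/-- An ideal of `L = M ⊕ Fz` not contained in `M` is `I ⊕ F(x + z)` with `x` in the radical of `M`
and in the centralizer of a given Levi factor of `M`. -/
theorem exists_eq_shiftedIdeal (hL : IsCompl M.toSubmodule (Submodule.span F {z}))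
    (hzc : z ∈ LieAlgebra.center F L)
    {S : LieSubalgebra F M} (hS : IsLeviFactor S) (V : LieIdeal F L) (hV : ¬ V ≤ M) :
    ∃ (I : LieIdeal F M) (x : M), x ∈ radical F M ∧ (∀ s ∈ S, ⁅s, x⁆ = 0) ∧
      (∀ m : M, ⁅m, x⁆ ∈ I) ∧ V.toSubmodule = shiftedIdeal M z I x := by
  obtain ⟨v, hvV, hvM⟩ := SetLike.not_le_iff_exists.mp hV
  obtain ⟨m₀, c, rfl⟩ := exists_eq_add_smul hL v
  have hc : c ≠ 0 := fun h ↦ hvM (by rw [h, zero_smul, add_zero]; exact m₀.2)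
  obtain ⟨m, hm⟩ : ∃ m : M, (m : L) + z ∈ V := ⟨c⁻¹ • m₀, by
    have := V.smul_mem c⁻¹ hvV
    rwa [smul_add, smul_smul, inv_mul_cancel₀ hc, one_smul] at this⟩
  have hVI (y : M) : y ∈ LieIdeal.comap M.incl V ↔ (y : L) ∈ V := Iff.rfl
  -- `[y, m] = [y, m + z]`, which lies in both `V` and `M`.
  have hcentral (y : M) : ⁅y, m⁆ ∈ LieIdeal.comap M.incl V := by
    have h0 : ⁅(y : L), z⁆ = 0 := hzc y
    have h1 := lie_mem_right F L V y _ hm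
    rwa [lie_add, h0, add_zero] at h1
  obtain ⟨x, hx, hxS, hmx⟩ := exists_mem_radical_centralizer_of_central_mod hS _ m hcentral
  have hxz : (x : L) + z ∈ V := by
    have := sub_mem hm ((hVI _).mp hmx)
    rw [LieSubmodule.coe_sub] at this
    convert this using 1
    abel
  refine ⟨LieIdeal.comap M.incl V, x, hx, hxS, fun y ↦ ?_, le_antisymm (fun v hv ↦ ?_) ?_⟩
  · have := sub_mem (hcentral y) (lie_mem_right F M _ y _ hmx)
    rwa [← lie_sub, sub_sub_cancel] at this
  · obtain ⟨y, a, rfl⟩ := exists_eq_add_smul hL v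
    refine Submodule.mem_sup.mpr ⟨((y - a • x : M) : L), ?_, a • ((x : L) + z),
      Submodule.smul_mem _ a (Submodule.mem_span_singleton_self _), ?_⟩
    · refine coe_mem_subspaceIn.mpr ((hVI _).mpr ?_)
      have := sub_mem (H := V) hv (V.smul_mem a hxz)
      rw [LieSubmodule.coe_sub, LieSubmodule.coe_smul]
      convert this using 1
      rw [smul_add]; abel
    · rw [LieSubmodule.coe_sub, LieSubmodule.coe_smul, smul_add]; abel
  · refine sup_le ?_ ?_
    · rintro _ ⟨y, hy, rfl⟩
      exact hy
    · rwa [Submodule.span_singleton_le_iff_mem]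

theorem isLieIdeal_iff (hM : ⁅M, M⁆ = M) (hz : z ≠ 0)
    (hL : IsCompl M.toSubmodule (Submodule.span F {z})) (hzc : z ∈ LieAlgebra.center F L)
    {S : LieSubalgebra F M} (hS : IsLeviFactor S) (V : Submodule F L) :
    IsLieIdeal V ↔
      (∃ I : LieIdeal F M, V = subspaceIn M I.toSubmodule) ∨
      (∃ I : LieIdeal F M,
        IsInternalSum V (subspaceIn M I.toSubmodule) (Submodule.span F {z})) ∨
      (lieJacobsonTrivial S ≠ ⊥ ∧ ∃ (I : LieIdeal F M) (x : M), IsShiftPair S I x ∧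
        IsInternalSum V (subspaceIn M I.toSubmodule) (Submodule.span F {(x : L) + z})) := by
  have hJ := lieJacobson_eq_radical_of_perfect (lie_top_eq_top_of_lie_self_eq hM)
  constructor
  · rintro ⟨V, rfl⟩
    by_cases hV : V ≤ M
    · refine Or.inl ⟨LieIdeal.comap M.incl V, ?_⟩
      ext v
      exact ⟨fun hv ↦ ⟨⟨v, hV hv⟩, hv, rfl⟩, by rintro ⟨y, hy, rfl⟩; exact hy⟩
    right
    obtain ⟨I, x, hx, hxS, hxI, hVI⟩ := exists_eq_shiftedIdeal hL hzc hS V hV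
    by_cases hxmem : x ∈ I
    · refine Or.inl ⟨I, ?_, by simpa using disjoint_subspaceIn_span hz hL I.toSubmodule 0⟩
      have hxI' : (x : L) ∈ subspaceIn M I.toSubmodule := coe_mem_subspaceIn.mpr hxmem
      rw [hVI, shiftedIdeal]
      refine le_antisymm (sup_le le_sup_left ?_) (sup_le le_sup_left ?_) <;>
        rw [Submodule.span_singleton_le_iff_mem]
      · exact add_mem (Submodule.mem_sup_left hxI')
          (Submodule.mem_sup_right (Submodule.mem_span_singleton_self z))
      · have := sub_mem (Submodule.mem_sup_right (Submodule.mem_span_singleton_self ((x : L) + z)))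
          (Submodule.mem_sup_left (T := Submodule.span F {(x : L) + z}) hxI')
        rwa [add_sub_cancel_left] at this
    · have hxJ : x ∈ lieJacobsonTrivial S :=
        ⟨by rw [hJ]; exact hx, fun s ↦ hxS s s.2⟩
      refine Or.inr ⟨fun h ↦ hxmem ?_, I, x, ⟨hxJ, hxmem, fun y _ ↦ ?_⟩, hVI,
        disjoint_subspaceIn_span hz hL I.toSubmodule x⟩
      · rw [h, Submodule.mem_bot] at hxJ
        rw [hxJ]
        exact zero_mem I
      · rw [← lie_skew]
        exact neg_mem (hxI y)
  · rintro (⟨I, rfl⟩ | ⟨I, rfl, -⟩ | ⟨-, I, x, hx, rfl, -⟩)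
    · exact isLieIdeal_subspaceIn hL hzc I
    -- Type (ii) is the shifted ideal with `x = 0`.
    · simpa [shiftedIdeal] using isLieIdeal_shiftedIdeal hL hzc I 0 (by simp)
    · exact isLieIdeal_shiftedIdeal hL hzc I x (hx.lie_mem hM hS)

end JacobsonRadical

/-! ### The main theorem. -/

theorem mainTheorem10 {F L : Type*} [Field F] [CharZero F] [LieRing L] [LieAlgebra F L]
    [FiniteDimensional F L] (M : LieIdeal F L) (z : L)
    (hM : ⁅M, M⁆ = M) (hz : z ≠ 0) (hzc : z ∈ LieAlgebra.center F L)
    (hL : IsCompl M.toSubmodule (Submodule.span F {z})) :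
    (∃ S : LieSubalgebra F M, IsLeviFactor S) ∧
    (lieJacobson F L).toSubmodule = subspaceIn M (lieJacobson F M).toSubmodule ∧
    IsInternalSum (LieAlgebra.radical F L).toSubmodule
      (Submodule.span F {z}) (lieJacobson F L).toSubmodule ∧
    ⁅(⊤ : LieIdeal F L), (⊤ : LieIdeal F L)⁆ = ⁅M, M⁆ ∧
    ∀ S : LieSubalgebra F M, IsLeviFactor S →
      (M ≠ ⊥ → S ≠ ⊥) ∧
      IsInternalSum (⁅(⊤ : LieIdeal F L), (⊤ : LieIdeal F L)⁆ : LieIdeal F L).toSubmodule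
        (subspaceIn M S.toSubmodule) (lieJacobson F L).toSubmodule ∧
      (∀ V : Submodule F L, IsLieIdeal V ↔
        (∃ I : LieIdeal F M, V = subspaceIn M I.toSubmodule) ∨
        (∃ I : LieIdeal F M,
          IsInternalSum V (subspaceIn M I.toSubmodule) (Submodule.span F {z})) ∨
        (lieJacobsonTrivial S ≠ ⊥ ∧ ∃ (I : LieIdeal F M) (x : M), IsShiftPair S I x ∧
          IsInternalSum V (subspaceIn M I.toSubmodule) (Submodule.span F {(x : L) + z}))) ∧
      (∀ (I : LieIdeal F M) (x : M), IsShiftPair S I x →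
        (∀ α : F, IsLieIdeal (shiftedIdeal M z I (α • x)) ∧
          Disjoint (subspaceIn M I.toSubmodule) (Submodule.span F {((α • x : M) : L) + z})) ∧
        (∀ α β : F,
          shiftedIdeal M z I (α • x) = shiftedIdeal M z I (β • x) ↔ α = β)) := by
  refine ⟨exists_isLeviFactor, lieJacobson_eq_subspaceIn hM hL hzc,
    isInternalSum_radical hM hz hL hzc, (derived_eq_of_isCompl hM hL hzc).trans hM.symm,
    fun S hS ↦ ⟨fun hM0 hS0 ↦ hM0 ?_, isInternalSum_leviFactor hM hL hzc hS,
      isLieIdeal_iff hM hz hL hzc hS, fun I x hx ↦ ⟨fun α ↦ ⟨?_, ?_⟩, fun α β ↦ ?_⟩⟩⟩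
  -- If `S = 0`, then `M = Rad M` is both solvable and perfect, hence zero.
  · have hrad : (LieAlgebra.radical F M).toSubmodule = ⊤ := by
      have := hS.isCompl.sup_eq_top
      rwa [hS0, LieSubalgebra.bot_toSubmodule, bot_sup_eq] at this
    apply eq_bot_of_isSolvable_of_lie_self_eq hM
    let j : M →ₗ⁅F⁆ LieAlgebra.radical F M :=
      { toFun := fun y ↦ ⟨y, by rw [← LieSubmodule.mem_toSubmodule, hrad]; trivial⟩
        map_add' := fun _ _ ↦ rfl
        map_smul' := fun _ _ ↦ rfl
        map_lie' := rfl }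
    have hj : Function.Injective j := fun a b h ↦
      congrArg (fun w : LieAlgebra.radical F M ↦ (w : M)) h
    exact hj.lieAlgebra_isSolvable
  · exact isLieIdeal_shiftedIdeal hL hzc I _ fun m ↦ by
      rw [lie_smul]
      exact I.smul_mem α (hx.lie_mem hM hS m)
  · exact disjoint_subspaceIn_span hz hL I.toSubmodule _
  · exact (shiftedIdeal_smul_injective hz hL hx.2.1).eq_iff
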